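/- A lattice is a finitely generated free abelian group with an integral symmetric bilinear form; $L(m)$ is $L$ with its form multiplied by $m$. Let $U$ be the hyperbolic plane (Gram matrix $\begin{pmatrix}0&1\\1&0\end{pmatrix}$), let $\langle -4\rangle$ be the rank one lattice generated by an element of square $-4$, and let $E_7$, $E_8$ be the root lattices taken negative definite (Gram matrix the negative of the Cartan matrix). Put $$T=U(2)\oplus U(2)\oplus\langle -4\rangle,\qquad N=U\oplus U(2)\oplus E_8(2),$$ with orthogonal direct sums. Let $\varphi\colon T\to N$ be a primitive embedding, that is, an injective homomorphism preserving the bilinear forms such that $N/\varphi(T)$ is torsion free, and let $K=\varphi(T)^{\perp}\subset N$ be the orthogonal complement of its image, with the form induced from $N$. If $K$ contains no element $x$ with $x\cdot x=-2$, then $K$ is isometric to $E_7(2)$. -/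

import Mathlib

namespace EnriquesLattice

open LinearMap (BilinForm)

/-- The orthogonal direct sum of two integral bilinear forms: on `M₁ × M₂` it is
`⟨(x₁, x₂), (y₁, y₂)⟩ = B₁ x₁ y₁ + B₂ x₂ y₂`. -/
noncomputable def orthSum {M₁ M₂ : Type} [AddCommGroup M₁] [AddCommGroup M₂]
    (B₁ : BilinForm ℤ M₁) (B₂ : BilinForm ℤ M₂) : BilinForm ℤ (M₁ × M₂) :=
  B₁.compl₁₂ (LinearMap.fst ℤ M₁ M₂) (LinearMap.fst ℤ M₁ M₂) +
    B₂.compl₁₂ (LinearMap.snd ℤ M₁ M₂) (LinearMap.snd ℤ M₁ M₂)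

@[simp] theorem orthSum_apply {M₁ M₂ : Type} [AddCommGroup M₁] [AddCommGroup M₂]
    (B₁ : BilinForm ℤ M₁) (B₂ : BilinForm ℤ M₂) (x y : M₁ × M₂) :
    orthSum B₁ B₂ x y = B₁ x.1 y.1 + B₂ x.2 y.2 := rfl

/-- The hyperbolic plane `U`. -/
noncomputable def U : BilinForm ℤ (Fin 2 → ℤ) := Matrix.toBilin' !![0, 1; 1, 0]

/-- The rank one lattice `⟨n⟩`, generated by an element of square `n`. -/
noncomputable def rankOne (n : ℤ) : BilinForm ℤ (Fin 1 → ℤ) := Matrix.toBilin' !![n]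

/-- The negative definite root lattice `E₇`. -/
noncomputable def E7 : BilinForm ℤ (Fin 7 → ℤ) := Matrix.toBilin' (-CartanMatrix.E₇)

/-- The negative definite root lattice `E₈`. -/
noncomputable def E8 : BilinForm ℤ (Fin 8 → ℤ) := Matrix.toBilin' (-CartanMatrix.E₈)

/-- The twist `L(m)`: the same group with the form multiplied by `m`. -/
noncomputable def twist {M : Type} [AddCommGroup M] (B : BilinForm ℤ M) (m : ℤ) :
    BilinForm ℤ M := m • B

/-- The lattice `T = U(2) ⊕ U(2) ⊕ ⟨-4⟩`. -/
noncomputable def formT : BilinForm ℤ ((Fin 2 → ℤ) × (Fin 2 → ℤ) × (Fin 1 → ℤ)) :=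
  orthSum (twist U 2) (orthSum (twist U 2) (rankOne (-4)))

/-- The lattice `N = U ⊕ U(2) ⊕ E₈(2)`. -/
noncomputable def formN : BilinForm ℤ ((Fin 2 → ℤ) × (Fin 2 → ℤ) × (Fin 8 → ℤ)) :=
  orthSum U (orthSum (twist U 2) (twist E8 2))

/-- A primitive embedding of lattices: an injective homomorphism preserving the forms
(preservation is part of the type of `φ`) whose image is a primitive subgroup, i.e. whose
cokernel is torsion free. -/
structure IsPrimitiveEmbedding {M₁ M₂ : Type} [AddCommGroup M₁] [AddCommGroup M₂]
    {B₁ : BilinForm ℤ M₁} {B₂ : BilinForm ℤ M₂} (φ : B₁ →bᵢ B₂) : Prop where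
  injective : Function.Injective φ
  primitive : ∀ (n : ℤ) (x : M₂), n ≠ 0 → n • x ∈ φ.toLinearMap.range → x ∈ φ.toLinearMap.range

/-- The orthogonal complement of the image of an embedding of lattices. -/
noncomputable def complement {M₁ M₂ : Type} [AddCommGroup M₁] [AddCommGroup M₂]
    {B₁ : BilinForm ℤ M₁} {B₂ : BilinForm ℤ M₂} (φ : B₁ →bᵢ B₂) : Submodule ℤ M₂ :=
  B₂.orthogonal φ.toLinearMap.range

end EnriquesLattice

/-! Write `T = L₀(2)` with `L₀ = U ⊕ U ⊕ ⟨-2⟩`, and let `L = U ⊕ U ⊕ E₈`, an even unimodular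
lattice. Requiring one of the two coordinates of the summand `U` of `N` to be even cuts out an index
two sublattice isometric to `L(2)`. The form of `T` takes even values and its squares are divisible
by 4, so the image of `T` in `U / 2U` is totally singular. Hence `φ(T)` lies in one of these two
sublattices, and `swapN` exchanges them.

Inside `L`, all embeddings of `L₀` are equivalent (`exists_isometry_standardVectors`). The
hyperbolic pairs are moved to standard position by Eichler transvections, and the remaining root of
`E₈` by the Weyl group. So the complement of `L₀` in `L` is the complement of the highest root in
`E₈`, which is `E₇`.

It remains to compare complements in `L(2)` and in `N`, where `N` is obtained by adjoining half of
an isotropic vector `w`. If `w` pairs oddly in `L` with some vector of `L₀`, the complement does not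
grow and is `E₇(2)`. Otherwise `w` is congruent modulo `2L` to a vector of square `-4` in the
complement `E₇` (`exists_E8_self_eq_neg_four`). Half of that vector lies in `N` and has square `2 ·
(-4) / 4 = -2`, which is excluded (`exists_root_orthogonal`). -/

namespace EnriquesLattice

open LinearMap (BilinForm)

/-! ### Hyperbolic planes and Eichler transvections. -/

section Hyperbolic

variable {M : Type} [AddCommGroup M] (B : BilinForm ℤ M)

/-- The orthogonal sum of a hyperbolic plane and a lattice, in coordinates. -/
noncomputable def hyperbolic : BilinForm ℤ (ℤ × ℤ × M) :=
  LinearMap.mk₂ ℤ (fun x y => x.1 * y.2.1 + x.2.1 * y.1 + B x.2.2 y.2.2)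
    (fun x y z => by simp; ring) (fun c x y => by simp; ring)
    (fun x y z => by simp; ring) (fun c x y => by simp; ring)

@[simp] theorem hyperbolic_apply (x y : ℤ × ℤ × M) :
    hyperbolic B x y = x.1 * y.2.1 + x.2.1 * y.1 + B x.2.2 y.2.2 := rfl

variable {B}

theorem hyperbolic_symm (hs : ∀ x y, B x y = B y x) (x y : ℤ × ℤ × M) :
    hyperbolic B x y = hyperbolic B y x := by
  simp only [hyperbolic_apply, hs x.2.2]; ring

/-- The Eichler transvection of `U ⊕ M` that fixes the first basis vector of `U`, attached to an
element `y` of `M` of square `2 q`. -/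
noncomputable def transvection (hs : ∀ x y, B x y = B y x) (y : M) (q : ℤ) (hq : B y y = 2 * q) :
    (hyperbolic B).IsometryEquiv (hyperbolic B) where
  toFun p := (p.1 - B p.2.2 y - p.2.1 * q, p.2.1, p.2.2 + p.2.1 • y)
  map_add' p p' := by
    ext
    · simp; ring
    · simp
    · simp only [Prod.snd_add, Prod.fst_add]; module
  map_smul' c p := by
    ext
    · simp; ring
    · simp
    · simp only [Prod.smul_snd, Prod.smul_fst, RingHom.id_apply]; module
  invFun p := (p.1 + B p.2.2 y - p.2.1 * q, p.2.1, p.2.2 - p.2.1 • y)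
  left_inv p := by
    ext
    · simp [hq]; ring
    · simp
    · simp
  right_inv p := by
    ext
    · simp [hq]; ring
    · simp
    · simp
  map_app' p p' := by
    simp [hq, hs y]; ring

@[simp] theorem transvection_apply (hs : ∀ x y, B x y = B y x) (y : M) (q : ℤ)
    (hq : B y y = 2 * q) (p : ℤ × ℤ × M) :
    transvection hs y q hq p = (p.1 - B p.2.2 y - p.2.1 * q, p.2.1, p.2.2 + p.2.1 • y) := rfl

variable (B) in
/-- The isometry of `U ⊕ M` that exchanges the two basis vectors of `U`. -/
noncomputable def hyperbolicSwap : (hyperbolic B).IsometryEquiv (hyperbolic B) where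
  toFun p := (p.2.1, p.1, p.2.2)
  map_add' _ _ := rfl
  map_smul' _ _ := rfl
  invFun p := (p.2.1, p.1, p.2.2)
  left_inv _ := rfl
  right_inv _ := rfl
  map_app' p p' := by simp; ring

@[simp] theorem hyperbolicSwap_apply (p : ℤ × ℤ × M) :
    hyperbolicSwap B p = (p.2.1, p.1, p.2.2) := rfl

/-- The extension of an isometry of `M` to `U ⊕ M` by the identity on `U`. -/
noncomputable def hyperbolicLift (g : B.IsometryEquiv B) :
    (hyperbolic B).IsometryEquiv (hyperbolic B) where
  toFun p := (p.1, p.2.1, g p.2.2)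
  map_add' _ _ := by simp
  map_smul' _ _ := by simp
  invFun p := (p.1, p.2.1, g.symm p.2.2)
  left_inv p := by
    ext
    · rfl
    · rfl
    · exact g.toLinearEquiv.symm_apply_apply _
  right_inv p := by
    ext
    · rfl
    · rfl
    · exact g.toLinearEquiv.apply_symm_apply _
  map_app' p p' := by simp

@[simp] theorem hyperbolicLift_apply (g : B.IsometryEquiv B) (p : ℤ × ℤ × M) :
    hyperbolicLift g p = (p.1, p.2.1, g p.2.2) := rfl

variable (B) in
/-- Multiplication by `-1`. -/
noncomputable def negIsometry : B.IsometryEquiv B where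
  __ := LinearEquiv.neg ℤ
  map_app' p p' := by simp

@[simp] theorem negIsometry_apply (p : M) : negIsometry B p = -p := rfl

variable (B) in
/-- The isometry of `U ⊕ U ⊕ M` that exchanges the two hyperbolic planes. -/
noncomputable def hyperbolicComm :
    (hyperbolic (hyperbolic B)).IsometryEquiv (hyperbolic (hyperbolic B)) where
  toFun p := (p.2.2.1, p.2.2.2.1, p.1, p.2.1, p.2.2.2.2)
  map_add' _ _ := rfl
  map_smul' _ _ := rfl
  invFun p := (p.2.2.1, p.2.2.2.1, p.1, p.2.1, p.2.2.2.2)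
  left_inv _ := rfl
  right_inv _ := rfl
  map_app' p p' := by simp; ring

@[simp] theorem hyperbolicComm_apply (p : ℤ × ℤ × ℤ × ℤ × M) :
    hyperbolicComm B p = (p.2.2.1, p.2.2.2.1, p.1, p.2.1, p.2.2.2.2) := rfl

/-- The reflection in a vector of square `-2`. -/
noncomputable def rootReflection (hs : ∀ x y, B x y = B y x) (r : M) (hr : B r r = -2) :
    B.IsometryEquiv B where
  toFun x := x + B x r • r
  map_add' x y := by simp; module
  map_smul' c x := by simp; module
  invFun x := x + B x r • r
  left_inv x := by simp [hr]; module
  right_inv x := by simp [hr]; module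
  map_app' x y := by simp [hr, hs r]; ring

@[simp] theorem rootReflection_apply (hs : ∀ x y, B x y = B y x) (r : M) (hr : B r r = -2)
    (x : M) : rootReflection hs r hr x = x + B x r • r := rfl

@[simp] theorem isometryEquiv_trans_apply (g h : B.IsometryEquiv B) (x : M) :
    (g.trans h) x = h (g x) := rfl

@[simp] theorem isometryEquiv_apply_symm_apply (g : B.IsometryEquiv B) (x : M) :
    g (g.symm x) = x := g.toLinearEquiv.apply_symm_apply x

@[simp] theorem isometryEquiv_symm_apply_apply (g : B.IsometryEquiv B) (x : M) :
    g.symm (g x) = x := g.toLinearEquiv.symm_apply_apply x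

/-- If every isotropic vector `z` with `z · w = 1` for some `w` is equivalent to the first basis
vector of `U`, then every hyperbolic pair is equivalent to the standard one. -/
theorem exists_isometry_hyperbolic_pair (hs : ∀ x y, B x y = B y x)
    {z w : ℤ × ℤ × M} (hzw : hyperbolic B z w = 1) (hw : hyperbolic B w w = 0)
    (he : ∃ g : (hyperbolic B).IsometryEquiv (hyperbolic B), g z = (1, 0, 0)) :
    ∃ g : (hyperbolic B).IsometryEquiv (hyperbolic B), g z = (1, 0, 0) ∧ g w = (0, 1, 0) := by
  obtain ⟨g, hg⟩ := he
  rcases hgw : g w with ⟨a, b, y⟩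
  have h1 : hyperbolic B (g z) (g w) = 1 := by rw [LinearMap.BilinForm.IsometryEquiv.map_app, hzw]
  have h2 : hyperbolic B (g w) (g w) = 0 := by rw [LinearMap.BilinForm.IsometryEquiv.map_app, hw]
  rw [hg, hgw] at h1
  rw [hgw] at h2
  simp at h1 h2
  subst h1
  -- The transvection along `-y` fixes `(1, 0, 0)` and clears the `M`-component of `g w`; isotropy
  -- then forces its first coordinate to vanish.
  have h3 : B (-y) (-y) = 2 * (-a) := by simp; linarith
  refine ⟨g.trans (transvection hs (-y) (-a) h3), ?_, ?_⟩
  · simp [hg]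
  · simp [hgw]
    linarith

end Hyperbolic

/-! ### The `E₈` lattice: definiteness, Weyl chamber, roots, covering radius. -/

section RootLattice

theorem E8_apply (x y : Fin 8 → ℤ) : E8 x y =
    -(x 0 * (2 * y 0 - y 2) + x 1 * (2 * y 1 - y 3) + x 2 * (2 * y 2 - y 0 - y 3)
      + x 3 * (2 * y 3 - y 1 - y 2 - y 4) + x 4 * (2 * y 4 - y 3 - y 5)
      + x 5 * (2 * y 5 - y 4 - y 6) + x 6 * (2 * y 6 - y 5 - y 7) + x 7 * (2 * y 7 - y 6)) := by
  simp [E8, Matrix.toBilin'_apply, Fin.sum_univ_eight, CartanMatrix.E₈]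
  ring

theorem E7_apply (x y : Fin 7 → ℤ) : E7 x y =
    -(x 0 * (2 * y 0 - y 2) + x 1 * (2 * y 1 - y 3) + x 2 * (2 * y 2 - y 0 - y 3)
      + x 3 * (2 * y 3 - y 1 - y 2 - y 4) + x 4 * (2 * y 4 - y 3 - y 5)
      + x 5 * (2 * y 5 - y 4 - y 6) + x 6 * (2 * y 6 - y 5)) := by
  simp [E7, Matrix.toBilin'_apply, Fin.sum_univ_seven, CartanMatrix.E₇]
  ring

theorem E8_symm (x y : Fin 8 → ℤ) : E8 x y = E8 y x := by
  simp only [E8_apply]; ring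

/-- Successive completion of squares along the Dynkin diagram; it makes negative definiteness
visible. -/
theorem E8_self_eq_sum_sq (x : Fin 8 → ℤ) : -60 * E8 x x =
    30 * (2 * x 0 - x 2) ^ 2 + 30 * (2 * x 1 - x 3) ^ 2 + 10 * (3 * x 2 - 2 * x 3) ^ 2
      + 2 * (5 * x 3 - 6 * x 4) ^ 2 + 3 * (4 * x 4 - 5 * x 5) ^ 2 + 5 * (3 * x 5 - 4 * x 6) ^ 2
      + 10 * (2 * x 6 - 3 * x 7) ^ 2 + 30 * x 7 ^ 2 := by
  rw [E8_apply]; ring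

theorem E8_self_nonpos (x : Fin 8 → ℤ) : E8 x x ≤ 0 := by
  have h := E8_self_eq_sum_sq x
  have : 0 ≤ -60 * E8 x x := by rw [h]; positivity
  linarith

theorem eq_zero_of_E8_self_eq_zero {x : Fin 8 → ℤ} (hx : E8 x x = 0) : x = 0 := by
  have h := E8_self_eq_sum_sq x
  rw [hx] at h
  have h0 := sq_nonneg (2 * x 0 - x 2)
  have h1 := sq_nonneg (2 * x 1 - x 3)
  have h2 := sq_nonneg (3 * x 2 - 2 * x 3)
  have h3 := sq_nonneg (5 * x 3 - 6 * x 4)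
  have h4 := sq_nonneg (4 * x 4 - 5 * x 5)
  have h5 := sq_nonneg (3 * x 5 - 4 * x 6)
  have h6 := sq_nonneg (2 * x 6 - 3 * x 7)
  have h7 := sq_nonneg (x 7)
  have k0 : 2 * x 0 - x 2 = 0 := pow_eq_zero_iff (two_ne_zero) |>.1 (by linarith)
  have k1 : 2 * x 1 - x 3 = 0 := pow_eq_zero_iff (two_ne_zero) |>.1 (by linarith)
  have k2 : 3 * x 2 - 2 * x 3 = 0 := pow_eq_zero_iff (two_ne_zero) |>.1 (by linarith)
  have k3 : 5 * x 3 - 6 * x 4 = 0 := pow_eq_zero_iff (two_ne_zero) |>.1 (by linarith)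
  have k4 : 4 * x 4 - 5 * x 5 = 0 := pow_eq_zero_iff (two_ne_zero) |>.1 (by linarith)
  have k5 : 3 * x 5 - 4 * x 6 = 0 := pow_eq_zero_iff (two_ne_zero) |>.1 (by linarith)
  have k6 : 2 * x 6 - 3 * x 7 = 0 := pow_eq_zero_iff (two_ne_zero) |>.1 (by linarith)
  have k7 : x 7 = 0 := pow_eq_zero_iff (two_ne_zero) |>.1 (by linarith)
  ext i
  fin_cases i <;> simp <;> omega

theorem exists_E8_self_eq (x : Fin 8 → ℤ) : ∃ q, E8 x x = 2 * q := by
  refine ⟨-(x 0 ^ 2 + x 1 ^ 2 + x 2 ^ 2 + x 3 ^ 2 + x 4 ^ 2 + x 5 ^ 2 + x 6 ^ 2 + x 7 ^ 2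
    - x 0 * x 2 - x 1 * x 3 - x 2 * x 3 - x 3 * x 4 - x 4 * x 5 - x 5 * x 6 - x 6 * x 7), ?_⟩
  rw [E8_apply]; ring

/-- Unimodularity of `E₈`. -/
theorem exists_eq_smul_of_dvd_E8 {a : ℤ} {x : Fin 8 → ℤ} (h : ∀ y, a ∣ E8 x y) :
    ∃ x', x = a • x' := by
  -- The test vectors are the rows of the inverse Cartan matrix, so each pairing is minus a single
  -- coordinate of `x`.
  have key : ∀ i, ∃ c, x i = a * c := by
    intro i
    fin_cases i
    · obtain ⟨c, hc⟩ := h ![4, 5, 7, 10, 8, 6, 4, 2]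
      exact ⟨-c, by simp [E8_apply] at hc ⊢; linarith⟩
    · obtain ⟨c, hc⟩ := h ![5, 8, 10, 15, 12, 9, 6, 3]
      exact ⟨-c, by simp [E8_apply] at hc ⊢; linarith⟩
    · obtain ⟨c, hc⟩ := h ![7, 10, 14, 20, 16, 12, 8, 4]
      exact ⟨-c, by simp [E8_apply] at hc ⊢; linarith⟩
    · obtain ⟨c, hc⟩ := h ![10, 15, 20, 30, 24, 18, 12, 6]
      exact ⟨-c, by simp [E8_apply] at hc ⊢; linarith⟩
    · obtain ⟨c, hc⟩ := h ![8, 12, 16, 24, 20, 15, 10, 5]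
      exact ⟨-c, by simp [E8_apply] at hc ⊢; linarith⟩
    · obtain ⟨c, hc⟩ := h ![6, 9, 12, 18, 15, 12, 8, 4]
      exact ⟨-c, by simp [E8_apply] at hc ⊢; linarith⟩
    · obtain ⟨c, hc⟩ := h ![4, 6, 8, 12, 10, 8, 6, 3]
      exact ⟨-c, by simp [E8_apply] at hc ⊢; linarith⟩
    · obtain ⟨c, hc⟩ := h ![2, 3, 4, 6, 5, 4, 3, 2]
      exact ⟨-c, by simp [E8_apply] at hc ⊢; linarith⟩
  choose c hc using key
  exact ⟨c, funext fun i => by simp [hc i]⟩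

/-- The highest root of `E₈`. -/
def highestRoot : Fin 8 → ℤ := ![2, 3, 4, 6, 5, 4, 3, 2]

theorem E8_highestRoot (x : Fin 8 → ℤ) : E8 highestRoot x = -x 7 := by
  simp [E8_apply, highestRoot]; ring

/-- Membership in the closed fundamental chamber of `E₈`. -/
structure IsDominant (x : Fin 8 → ℤ) : Prop where
  h0 : 0 ≤ 2 * x 0 - x 2
  h1 : 0 ≤ 2 * x 1 - x 3
  h2 : 0 ≤ 2 * x 2 - x 0 - x 3
  h3 : 0 ≤ 2 * x 3 - x 1 - x 2 - x 4
  h4 : 0 ≤ 2 * x 4 - x 3 - x 5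
  h5 : 0 ≤ 2 * x 5 - x 4 - x 6
  h6 : 0 ≤ 2 * x 6 - x 5 - x 7
  h7 : 0 ≤ 2 * x 7 - x 6

theorem E8_single_self (i : Fin 8) : E8 (Pi.single i 1) (Pi.single i 1) = -2 := by
  simp [E8, Matrix.toBilin'_single]

/-- Here `ρ` is the Weyl vector. An image of `x` nearest to `ρ` is dominant, since reflecting in a
simple root on whose wrong side it lies would bring it nearer. -/
theorem exists_isometry_isDominant (x : Fin 8 → ℤ) :
    ∃ g : E8.IsometryEquiv E8, IsDominant (g x) := by
  set ρ : Fin 8 → ℤ := ![46, 68, 91, 135, 110, 84, 57, 29] with hρ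
  have hρi : ∀ i, E8 ρ (Pi.single i 1) = -1 := by
    intro i; fin_cases i <;> simp [E8_apply, hρ]
  let f : E8.IsometryEquiv E8 → ℕ := fun g => (-E8 (g x - ρ) (g x - ρ)).toNat
  have : Nonempty (E8.IsometryEquiv E8) := ⟨.refl _⟩
  obtain ⟨g, hg⟩ : ∃ g, ∀ h, f g ≤ f h := ⟨Function.argmin f, fun h => Function.argmin_le f h⟩
  have key : ∀ i, E8 (g x) (Pi.single i 1) ≤ 0 := by
    intro i
    have h1 := hg (g.trans (rootReflection E8_symm (Pi.single i 1) (E8_single_self i)))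
    have h4 := E8_self_nonpos (g x - ρ)
    have h5 := E8_self_nonpos
      ((g.trans (rootReflection E8_symm (Pi.single i 1) (E8_single_self i))) x - ρ)
    replace h1 : -E8 (g x - ρ) (g x - ρ) ≤ -E8
        ((g.trans (rootReflection E8_symm (Pi.single i 1) (E8_single_self i))) x - ρ)
        ((g.trans (rootReflection E8_symm (Pi.single i 1) (E8_single_self i))) x - ρ) := by
      simp only [f] at h1
      omega
    simp only [isometryEquiv_trans_apply, rootReflection_apply] at h1
    generalize g x = y at *
    have h2 := E8_single_self i
    have h3 := hρi i
    simp only [map_add, map_sub, map_smul, LinearMap.add_apply, LinearMap.sub_apply,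
      LinearMap.smul_apply, smul_eq_mul, E8_symm (Pi.single i 1), h2, h3] at h1
    linarith
  refine ⟨g, ?_⟩
  generalize g x = y at *
  have k0 := key 0
  have k1 := key 1
  have k2 := key 2
  have k3 := key 3
  have k4 := key 4
  have k5 := key 5
  have k6 := key 6
  have k7 := key 7
  simp [E8_apply] at k0 k1 k2 k3 k4 k5 k6 k7
  constructor <;> linarith

/-- Let `cᵢ ≥ 0` be the chamber coordinates and `mᵢ` the coefficients of the highest root. Then `-E8
x x = ∑ cᵢ xᵢ` and `x 7 = ∑ mᵢ cᵢ`, and dominance gives `xᵢ ≤ mᵢ * x 7`. -/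
theorem IsDominant.neg_E8_self_le {x : Fin 8 → ℤ} (hx : IsDominant x) :
    0 ≤ x 7 ∧ -E8 x x ≤ x 7 ^ 2 := by
  obtain ⟨h0, h1, h2, h3, h4, h5, h6, h7⟩ := hx
  rw [E8_apply]
  refine ⟨by linarith, ?_⟩
  have k0 := mul_nonneg h0 (show 0 ≤ 2 * x 7 - x 0 by linarith)
  have k1 := mul_nonneg h1 (show 0 ≤ 3 * x 7 - x 1 by linarith)
  have k2 := mul_nonneg h2 (show 0 ≤ 4 * x 7 - x 2 by linarith)
  have k3 := mul_nonneg h3 (show 0 ≤ 6 * x 7 - x 3 by linarith)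
  have k4 := mul_nonneg h4 (show 0 ≤ 5 * x 7 - x 4 by linarith)
  have k5 := mul_nonneg h5 (show 0 ≤ 4 * x 7 - x 5 by linarith)
  have k6 := mul_nonneg h6 (show 0 ≤ 3 * x 7 - x 6 by linarith)
  have k7 := mul_nonneg h7 (show 0 ≤ 2 * x 7 - x 7 by linarith)
  linarith

/-- The inverse Cartan matrix has all entries at least 2, and diagonal entries at least 4 except the
last. Hence `xᵢ ≥ 2 ∑ cⱼ`, and `∑ cᵢ xᵢ = 2` forces `∑ cᵢ = 1` with `xᵢ = 2` wherever `cᵢ ≠ 0`, so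
only the last `cᵢ` survives. -/
theorem IsDominant.eq_highestRoot {x : Fin 8 → ℤ} (hx : IsDominant x) (h : E8 x x = -2) :
    x = highestRoot := by
  obtain ⟨h0, h1, h2, h3, h4, h5, h6, h7⟩ := hx
  have hne : x ≠ 0 := by rintro rfl; simp at h
  rw [E8_apply] at h
  obtain ⟨c0, e0⟩ : ∃ c, c = 2 * x 0 - x 2 := ⟨_, rfl⟩
  obtain ⟨c1, e1⟩ : ∃ c, c = 2 * x 1 - x 3 := ⟨_, rfl⟩
  obtain ⟨c2, e2⟩ : ∃ c, c = 2 * x 2 - x 0 - x 3 := ⟨_, rfl⟩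
  obtain ⟨c3, e3⟩ : ∃ c, c = 2 * x 3 - x 1 - x 2 - x 4 := ⟨_, rfl⟩
  obtain ⟨c4, e4⟩ : ∃ c, c = 2 * x 4 - x 3 - x 5 := ⟨_, rfl⟩
  obtain ⟨c5, e5⟩ : ∃ c, c = 2 * x 5 - x 4 - x 6 := ⟨_, rfl⟩
  obtain ⟨c6, e6⟩ : ∃ c, c = 2 * x 6 - x 5 - x 7 := ⟨_, rfl⟩
  obtain ⟨c7, e7⟩ : ∃ c, c = 2 * x 7 - x 6 := ⟨_, rfl⟩
  rw [← e0, ← e1, ← e2, ← e3, ← e4, ← e5, ← e6, ← e7] at h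
  rw [← e0] at h0
  rw [← e1] at h1
  rw [← e2] at h2
  rw [← e3] at h3
  rw [← e4] at h4
  rw [← e5] at h5
  rw [← e6] at h6
  rw [← e7] at h7
  have hs : 1 ≤ c0 + c1 + c2 + c3 + c4 + c5 + c6 + c7 := by
    by_contra hlt
    refine hne (funext fun i => ?_)
    fin_cases i <;> simp <;> omega
  have m0 : 0 ≤ c0 * (x 0 - 2) := mul_nonneg h0 (by linarith)
  have m1 : 0 ≤ c1 * (x 1 - 2) := mul_nonneg h1 (by linarith)
  have m2 : 0 ≤ c2 * (x 2 - 2) := mul_nonneg h2 (by linarith)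
  have m3 : 0 ≤ c3 * (x 3 - 2) := mul_nonneg h3 (by linarith)
  have m4 : 0 ≤ c4 * (x 4 - 2) := mul_nonneg h4 (by linarith)
  have m5 : 0 ≤ c5 * (x 5 - 2) := mul_nonneg h5 (by linarith)
  have m6 : 0 ≤ c6 * (x 6 - 2) := mul_nonneg h6 (by linarith)
  have m7 : 0 ≤ c7 * (x 7 - 2) := mul_nonneg h7 (by linarith)
  have hs' : c0 + c1 + c2 + c3 + c4 + c5 + c6 + c7 = 1 := by linarith
  have aux : ∀ c t : ℤ, 0 ≤ c → 4 * c ≤ t → c * (t - 2) = 0 → c = 0 := by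
    intro c t hc hct h0
    rcases mul_eq_zero.1 h0 with h0 | h0 <;> omega
  have n0 : c0 = 0 := aux c0 (x 0) h0 (by linarith) (by linarith)
  have n1 : c1 = 0 := aux c1 (x 1) h1 (by linarith) (by linarith)
  have n2 : c2 = 0 := aux c2 (x 2) h2 (by linarith) (by linarith)
  have n3 : c3 = 0 := aux c3 (x 3) h3 (by linarith) (by linarith)
  have n4 : c4 = 0 := aux c4 (x 4) h4 (by linarith) (by linarith)
  have n5 : c5 = 0 := aux c5 (x 5) h5 (by linarith) (by linarith)
  have n6 : c6 = 0 := aux c6 (x 6) h6 (by linarith) (by linarith)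
  have n7 : c7 = 1 := by linarith
  subst n0 n1 n2 n3 n4 n5 n6 n7
  funext i
  fin_cases i <;> simp [highestRoot] <;> omega

theorem exists_isometry_eq_highestRoot {x : Fin 8 → ℤ} (h : E8 x x = -2) :
    ∃ g : E8.IsometryEquiv E8, g x = highestRoot := by
  obtain ⟨g, hg⟩ := exists_isometry_isDominant x
  exact ⟨g, hg.eq_highestRoot (by simp [h])⟩

/-- The covering radius of `E₈` is at most `1`. -/
theorem exists_neg_E8_self_le (x : Fin 8 → ℤ) {b : ℤ} (hb : b ≠ 0) :
    ∃ y, -E8 (x + b • y) (x + b • y) ≤ b ^ 2 := by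
  wlog hb' : 0 < b generalizing b
  · obtain ⟨y, hy⟩ := this (neg_ne_zero.2 hb) (by omega)
    exact ⟨-y, by simpa using hy⟩
  let f : (Fin 8 → ℤ) → ℕ := fun y => (-E8 (x + b • y) (x + b • y)).toNat
  obtain ⟨y, hy⟩ : ∃ y, ∀ z, f y ≤ f z := ⟨Function.argmin f, fun z => Function.argmin_le f z⟩
  obtain ⟨g, hg⟩ := exists_isometry_isDominant (x + b • y)
  refine ⟨y, ?_⟩
  -- In the chamber, subtracting `b` times the highest root cannot shorten a minimal vector `u`.
  -- This gives `u 7 ≤ b`, and dominance bounds the norm by `(u 7) ^ 2`.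
  have h1 := hy (y - g.symm highestRoot)
  have h2 := E8_self_nonpos (x + b • y)
  have h3 := E8_self_nonpos (x + b • (y - g.symm highestRoot))
  simp only [f] at h1
  replace h1 : -E8 (x + b • y) (x + b • y) ≤
    -E8 (x + b • (y - g.symm highestRoot)) (x + b • (y - g.symm highestRoot)) := by omega
  have h4 : x + b • (y - g.symm highestRoot) = g.symm (g (x + b • y) - b • highestRoot) := by
    simp only [map_sub, map_smul, isometryEquiv_symm_apply_apply]
    module
  rw [h4, LinearMap.BilinForm.IsometryEquiv.map_app,
    ← LinearMap.BilinForm.IsometryEquiv.map_app g] at h1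
  rw [← LinearMap.BilinForm.IsometryEquiv.map_app g]
  generalize g (x + b • y) = u at *
  obtain ⟨h5, h6⟩ := hg.neg_E8_self_le
  have h7 : E8 highestRoot highestRoot = -2 := by rw [E8_highestRoot]; rfl
  simp only [map_sub, map_smul, LinearMap.sub_apply, LinearMap.smul_apply, smul_eq_mul, h7,
    E8_symm u highestRoot, E8_highestRoot] at h1
  have h8 : u 7 ≤ b := by
    by_contra hlt
    nlinarith
  nlinarith

end RootLattice

/-! ### Orbits of isotropic vectors and of embeddings of `U ⊕ U ⊕ ⟨-2⟩`. -/

section Orbits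

theorem hyperbolic_E8_symm (x y : ℤ × ℤ × (Fin 8 → ℤ)) :
    hyperbolic E8 x y = hyperbolic E8 y x := hyperbolic_symm E8_symm x y

theorem exists_isometry_eq_unit {M : Type} [AddCommGroup M] {B : BilinForm ℤ M}
    {z w : ℤ × ℤ × M} (hzw : hyperbolic B z w = 1)
    {g : (hyperbolic B).IsometryEquiv (hyperbolic B)} {a : ℤ} (hg : g z = (a, 0, 0)) :
    ∃ g : (hyperbolic B).IsometryEquiv (hyperbolic B), g z = (1, 0, 0) := by
  have h1 : hyperbolic B (g z) (g w) = 1 := by rw [LinearMap.BilinForm.IsometryEquiv.map_app, hzw]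
  rw [hg] at h1
  simp at h1
  rcases Int.isUnit_iff.1 (IsUnit.of_mul_eq_one _ h1) with rfl | rfl
  · exact ⟨g, hg⟩
  · exact ⟨g.trans (negIsometry _), by simp [hg]⟩

/-- Primitive isotropic vectors of `U ⊕ E₈` form a single orbit. -/
theorem exists_isometry_isotropic {z w : ℤ × ℤ × (Fin 8 → ℤ)}
    (hz : hyperbolic E8 z z = 0) (hzw : hyperbolic E8 z w = 1) :
    ∃ g : (hyperbolic E8).IsometryEquiv (hyperbolic E8), g z = (1, 0, 0) := by
  let f : (hyperbolic E8).IsometryEquiv (hyperbolic E8) → ℕ := fun g => (g z).2.1.natAbs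
  have : Nonempty ((hyperbolic E8).IsometryEquiv (hyperbolic E8)) := ⟨.refl _⟩
  obtain ⟨g, hg⟩ : ∃ g, ∀ h, f g ≤ f h := ⟨Function.argmin f, fun h => Function.argmin_le f h⟩
  rcases hgz : g z with ⟨a, b, x⟩
  have h0 : hyperbolic E8 (g z) (g z) = 0 := by
    rw [LinearMap.BilinForm.IsometryEquiv.map_app, hz]
  by_cases hb : b = 0
  · subst hb
    rw [hgz] at h0
    simp at h0
    rw [eq_zero_of_E8_self_eq_zero h0] at hgz
    exact exists_isometry_eq_unit hzw hgz
  · exfalso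
    -- Translating `x` by `b • y` makes `2 * a' * b = -E8 (x + b • y) (x + b • y) ≤ b ^ 2`, so `|a'|
    -- < |b|` and the swap contradicts minimality of `|b|`.
    obtain ⟨y, hy⟩ := exists_neg_E8_self_le x hb
    obtain ⟨q, hq⟩ := exists_E8_self_eq y
    set t := transvection E8_symm y q hq
    have h1 := hg ((g.trans t).trans (hyperbolicSwap E8))
    have h2 : hyperbolic E8 (t (g z)) (t (g z)) = 0 := by
      rw [LinearMap.BilinForm.IsometryEquiv.map_app, h0]
    simp only [f, isometryEquiv_trans_apply, hyperbolicSwap_apply] at h1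
    simp only [hgz, t, transvection_apply, hyperbolic_apply] at h1 h2
    generalize a - E8 x y - b * q = a' at h1 h2
    have h3 : |b| ≤ |a'| := by
      rw [Int.abs_eq_natAbs, Int.abs_eq_natAbs]; exact_mod_cast h1
    have h4 : -E8 (x + b • y) (x + b • y) = 2 * (a' * b) := by linarith
    have h5 : b ^ 2 ≤ a' * b := by
      have h6 : 0 ≤ a' * b := by linarith [E8_self_nonpos (x + b • y)]
      rw [← abs_of_nonneg h6, abs_mul, ← sq_abs]
      nlinarith [abs_nonneg b]
    have h6 : 0 < b ^ 2 := by positivity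
    linarith

/-- Primitive isotropic vectors of `U ⊕ U ⊕ E₈` form a single orbit. -/
theorem exists_isometry_isotropic₂ {z w : ℤ × ℤ × ℤ × ℤ × (Fin 8 → ℤ)}
    (hz : hyperbolic (hyperbolic E8) z z = 0) (hzw : hyperbolic (hyperbolic E8) z w = 1) :
    ∃ g : (hyperbolic (hyperbolic E8)).IsometryEquiv (hyperbolic (hyperbolic E8)),
      g z = (1, 0, 0) := by
  -- If the first coordinate vanished on the whole orbit, all four hyperbolic coordinates of `z`
  -- would vanish, and definiteness of `E₈` would give `z = 0`.
  have hne : ∃ n : ℕ, n ≠ 0 ∧ ∃ g : (hyperbolic (hyperbolic E8)).IsometryEquiv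
      (hyperbolic (hyperbolic E8)), (g z).1.natAbs = n := by
    by_contra hcon
    push Not at hcon
    have k : ∀ g : (hyperbolic (hyperbolic E8)).IsometryEquiv
      (hyperbolic (hyperbolic E8)), (g z).1 = 0 := fun g => by
      by_contra h
      exact hcon _ (Int.natAbs_ne_zero.2 h) g rfl
    have k1 := k (.refl _)
    have k2 := k (hyperbolicSwap _)
    have k3 := k (hyperbolicComm _)
    have k4 := k ((hyperbolicComm _).trans (hyperbolicSwap _))
    rcases z with ⟨a, b, c, d, x⟩
    change a = 0 at k1
    simp at k2 k3 k4
    subst k1 k2 k3 k4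
    simp at hz hzw
    rw [eq_zero_of_E8_self_eq_zero hz] at hzw
    simp at hzw
  classical
  obtain ⟨hn0, g₀, hg₀⟩ := Nat.find_spec hne
  have hmin : ∀ g : (hyperbolic (hyperbolic E8)).IsometryEquiv
      (hyperbolic (hyperbolic E8)), (g z).1 ≠ 0 → Nat.find hne ≤ (g z).1.natAbs := fun g h =>
    Nat.find_min' hne ⟨Int.natAbs_ne_zero.2 h, g, rfl⟩
  generalize Nat.find hne = n at *
  have hdvd : ∀ g : (hyperbolic (hyperbolic E8)).IsometryEquiv
      (hyperbolic (hyperbolic E8)), (g z).1.natAbs = n → (g z).1 ∣ (g z).2.2.1 := by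
    intro g hg
    rcases hgz : g z with ⟨a, b, c, d, x⟩
    rw [hgz] at hg
    simp only at hg ⊢
    by_contra hnd
    -- A Euclidean step: this transvection replaces `c` by `c % a`, which is then moved to the first
    -- coordinate.
    have hq : hyperbolic E8 (-(c / a), 0, 0) (-(c / a), 0, 0) = 2 * 0 := by simp
    have h1 := hmin (((((g.trans (hyperbolicSwap _)).trans
      (transvection hyperbolic_E8_symm (-(c / a), 0, 0) 0 hq))).trans (hyperbolicComm _)))
    simp [hgz] at h1
    have h2 : c + -(a * (c / a)) = c % a := by rw [Int.emod_def]; ring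
    rw [h2] at h1
    have h3 := h1 (fun h => hnd (Int.dvd_of_emod_eq_zero h))
    have h4 := Int.emod_lt_abs c (show a ≠ 0 by omega)
    have h5 := Int.emod_nonneg c (show a ≠ 0 by omega)
    rw [Int.abs_eq_natAbs] at h4
    omega
  rcases hgz : g₀ z with ⟨a, b, c, d, x⟩
  rw [hgz] at hg₀
  simp only at hg₀
  have hc : a ∣ c := by simpa [hgz] using hdvd g₀ (by simpa [hgz] using hg₀)
  have hd : a ∣ d := by
    simpa [hgz] using hdvd (g₀.trans (hyperbolicLift (hyperbolicSwap E8))) (by simpa [hgz] using hg₀)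
  have hx : ∀ y, a ∣ E8 x y := by
    intro y
    obtain ⟨q, hq⟩ := exists_E8_self_eq y
    have h1 := hdvd (g₀.trans (hyperbolicLift (transvection E8_symm y q hq)))
      (by simpa [hgz] using hg₀)
    simp [hgz] at h1
    have h2 := dvd_sub (dvd_sub hc h1) (hd.mul_right q)
    rwa [show E8 x y = c - (c - E8 x y - d * q) - d * q by ring]
  obtain ⟨c', rfl⟩ := hc
  obtain ⟨d', rfl⟩ := hd
  obtain ⟨x', rfl⟩ := exists_eq_smul_of_dvd_E8 hx
  obtain ⟨q, hq⟩ := exists_E8_self_eq x'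
  -- Since `a` divides the whole `U ⊕ E₈` component, one transvection clears it.
  have hq' : hyperbolic E8 (-c', -d', -x') (-c', -d', -x') = 2 * (c' * d' + q) := by
    simp [hq]; ring
  have h1 : ((g₀.trans (hyperbolicSwap _)).trans
      (transvection hyperbolic_E8_symm (-c', -d', -x') _ hq')) z =
      (b - hyperbolic E8 (a * c', a * d', a • x') (-c', -d', -x') - a * (c' * d' + q), a, 0) := by
    simp [hgz]
  generalize b - hyperbolic E8 (a * c', a * d', a • x') (-c', -d', -x') - a * (c' * d' + q) = b'
    at h1
  have h2 : ((((g₀.trans (hyperbolicSwap _)).trans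
      (transvection hyperbolic_E8_symm (-c', -d', -x') _ hq'))).trans (hyperbolicSwap _)) z =
      (a, b', 0) := by
    rw [isometryEquiv_trans_apply, h1]; rfl
  generalize ((g₀.trans (hyperbolicSwap _)).trans
      (transvection hyperbolic_E8_symm (-c', -d', -x') _ hq')).trans (hyperbolicSwap _) = g at h2
  have h3 := hz
  rw [← LinearMap.BilinForm.IsometryEquiv.map_app g, h2] at h3
  have ha : a ≠ 0 := by omega
  obtain rfl : b' = 0 := by
    simp at h3
    exact (mul_eq_zero.1 (show a * b' = 0 by linarith)).resolve_left ha
  exact exists_isometry_eq_unit hzw h2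

/-- The standard basis of the copy of `U ⊕ U ⊕ ⟨-2⟩` in `U ⊕ U ⊕ E₈`. -/
def standardVectors : Fin 5 → ℤ × ℤ × ℤ × ℤ × (Fin 8 → ℤ) :=
  ![(1, 0, 0), (0, 1, 0), (0, 0, 1, 0, 0), (0, 0, 0, 1, 0), (0, 0, 0, 0, highestRoot)]

/-- The embeddings of `U ⊕ U ⊕ ⟨-2⟩` in `U ⊕ U ⊕ E₈` form a single orbit. -/
theorem exists_isometry_standardVectors {P : Fin 5 → ℤ × ℤ × ℤ × ℤ × (Fin 8 → ℤ)}
    (hP : ∀ i j, hyperbolic (hyperbolic E8) (P i) (P j) =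
      hyperbolic (hyperbolic E8) (standardVectors i) (standardVectors j)) :
    ∃ g : (hyperbolic (hyperbolic E8)).IsometryEquiv (hyperbolic (hyperbolic E8)),
      ∀ i, g (P i) = standardVectors i := by
  have hθ : E8 highestRoot highestRoot = -2 := by rw [E8_highestRoot]; rfl
  obtain ⟨g, hg0, hg1⟩ := exists_isometry_hyperbolic_pair hyperbolic_E8_symm
    (z := P 0) (w := P 1) (by rw [hP]; simp [standardVectors])
    (by rw [hP]; simp [standardVectors])
    (exists_isometry_isotropic₂ (w := P 1) (by rw [hP]; simp [standardVectors])
      (by rw [hP]; simp [standardVectors]))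
  have hP' : ∀ i j, hyperbolic (hyperbolic E8) (g (P i)) (g (P j)) =
      hyperbolic (hyperbolic E8) (standardVectors i) (standardVectors j) := fun i j => by
    rw [LinearMap.BilinForm.IsometryEquiv.map_app, hP]
  -- Orthogonality to the first plane puts the other three vectors in `U ⊕ E₈`, where the argument
  -- repeats.
  have hm : ∀ i : Fin 5, 2 ≤ i → ∃ m, g (P i) = (0, 0, m) := by
    intro i hi
    have h0 := hP' 0 i
    have h1 := hP' 1 i
    rw [hg0] at h0
    rw [hg1] at h1
    refine ⟨(g (P i)).2.2, ?_⟩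
    fin_cases i <;> simp [standardVectors] at hi h0 h1 ⊢ <;> ext <;> simp [h0, h1]
  obtain ⟨m2, hm2⟩ := hm 2 (by decide)
  obtain ⟨m3, hm3⟩ := hm 3 (by decide)
  obtain ⟨m4, hm4⟩ := hm 4 (by decide)
  have e22 := hP' 2 2
  have e23 := hP' 2 3
  have e33 := hP' 3 3
  have e24 := hP' 2 4
  have e34 := hP' 3 4
  have e44 := hP' 4 4
  rw [hm2] at e22
  rw [hm2, hm3] at e23
  rw [hm3] at e33
  rw [hm2, hm4] at e24
  rw [hm3, hm4] at e34
  rw [hm4] at e44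
  rw [hyperbolic_apply (hyperbolic E8)] at e22 e23 e33 e24 e34 e44
  simp only [mul_zero, zero_add] at e22 e23 e33 e24 e34 e44
  obtain ⟨k, hk2, hk3⟩ := exists_isometry_hyperbolic_pair E8_symm
    (z := m2) (w := m3) (by rw [e23]; simp [standardVectors])
    (by rw [e33]; simp [standardVectors])
    (exists_isometry_isotropic (w := m3) (by rw [e22]; simp [standardVectors])
      (by rw [e23]; simp [standardVectors]))
  rw [← LinearMap.BilinForm.IsometryEquiv.map_app k, hk2] at e24
  rw [← LinearMap.BilinForm.IsometryEquiv.map_app k, hk3] at e34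
  rw [← LinearMap.BilinForm.IsometryEquiv.map_app k] at e44
  rcases hk4 : k m4 with ⟨a, b, x⟩
  rw [hk4] at e24 e34 e44
  simp [standardVectors] at e24 e34
  subst e24 e34
  simp [standardVectors, hθ] at e44
  obtain ⟨l, hl⟩ := exists_isometry_eq_highestRoot e44
  refine ⟨(g.trans (hyperbolicLift k)).trans (hyperbolicLift (hyperbolicLift l)), fun i => ?_⟩
  fin_cases i
  · simp [hg0, standardVectors]
  · simp [hg1, standardVectors]
  · simp [hm2, hk2, standardVectors]
  · simp [hm3, hk3, standardVectors]
  · simp [hm4, hk4, hl, standardVectors]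

end Orbits

/-! ### The index two sublattice of `N`, and classes modulo two in `E₇`. -/

section Complement

theorem formN_apply (x y : (Fin 2 → ℤ) × (Fin 2 → ℤ) × (Fin 8 → ℤ)) :
    formN x y = x.1 0 * y.1 1 + x.1 1 * y.1 0
      + 2 * (x.2.1 0 * y.2.1 1 + x.2.1 1 * y.2.1 0) + 2 * E8 x.2.2 y.2.2 := by
  simp [formN, U, twist, Matrix.toBilin'_apply]; ring

theorem formT_apply (x y : (Fin 2 → ℤ) × (Fin 2 → ℤ) × (Fin 1 → ℤ)) :
    formT x y = 2 * (x.1 0 * y.1 1 + x.1 1 * y.1 0)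
      + 2 * (x.2.1 0 * y.2.1 1 + x.2.1 1 * y.2.1 0) - 4 * (x.2.2 0 * y.2.2 0) := by
  simp [formT, U, twist, rankOne, Matrix.toBilin'_apply]; ring

/-- The index two sublattice `(U ⊕ U ⊕ E₈)(2)` of `N`. -/
noncomputable def evenEmbedding :
    (ℤ × ℤ × ℤ × ℤ × (Fin 8 → ℤ)) →ₗ[ℤ] (Fin 2 → ℤ) × (Fin 2 → ℤ) × (Fin 8 → ℤ) where
  toFun p := (![p.1, 2 * p.2.1], ![p.2.2.1, p.2.2.2.1], p.2.2.2.2)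
  map_add' p q := by simp [mul_add]
  map_smul' c p := by simp [mul_left_comm]

@[simp] theorem evenEmbedding_apply (p : ℤ × ℤ × ℤ × ℤ × (Fin 8 → ℤ)) :
    evenEmbedding p = (![p.1, 2 * p.2.1], ![p.2.2.1, p.2.2.2.1], p.2.2.2.2) := rfl

theorem formN_evenEmbedding (p q : ℤ × ℤ × ℤ × ℤ × (Fin 8 → ℤ)) :
    formN (evenEmbedding p) (evenEmbedding q) = 2 * hyperbolic (hyperbolic E8) p q := by
  simp [formN_apply]; ring

theorem exists_evenEmbedding_eq {x : (Fin 2 → ℤ) × (Fin 2 → ℤ) × (Fin 8 → ℤ)}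
    (hx : 2 ∣ x.1 1) : ∃ p, evenEmbedding p = x := by
  obtain ⟨b, hb⟩ := hx
  refine ⟨(x.1 0, b, x.2.1 0, x.2.1 1, x.2.2), ?_⟩
  ext i
  · fin_cases i <;> simp [hb]
  · fin_cases i <;> simp
  · simp

theorem evenEmbedding_injective : Function.Injective evenEmbedding := by
  rintro ⟨a, b, c, d, x⟩ ⟨a', b', c', d', x'⟩ h
  simpa [and_assoc] using h

/-- The inclusion of `E₇` in `E₈` as the orthogonal complement of the highest root. -/
def inclE7 : (Fin 7 → ℤ) →ₗ[ℤ] (Fin 8 → ℤ) where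
  toFun x := ![x 0, x 1, x 2, x 3, x 4, x 5, x 6, 0]
  map_add' x y := by simp
  map_smul' c x := by simp

theorem inclE7_apply (x : Fin 7 → ℤ) : inclE7 x = ![x 0, x 1, x 2, x 3, x 4, x 5, x 6, 0] := rfl

theorem E8_inclE7 (x y : Fin 7 → ℤ) : E8 (inclE7 x) (inclE7 y) = E7 x y := by
  simp [inclE7_apply, E8_apply, E7_apply]

theorem exists_inclE7_eq {x : Fin 8 → ℤ} (hx : x 7 = 0) : ∃ y, inclE7 y = x := by
  refine ⟨![x 0, x 1, x 2, x 3, x 4, x 5, x 6], ?_⟩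
  ext i
  fin_cases i <;> simp [inclE7_apply, hx]

theorem inclE7_injective : Function.Injective inclE7 := by
  intro x y h
  simp only [inclE7_apply] at h
  ext i
  fin_cases i
  · exact congrFun h 0
  · exact congrFun h 1
  · exact congrFun h 2
  · exact congrFun h 3
  · exact congrFun h 4
  · exact congrFun h 5
  · exact congrFun h 6

/-- Half the square of an element of the positive definite lattice `E₇`. -/
def halfNormE7 (a b c d e f g : ℤ) : ℤ :=
  a * a + b * b + c * c + d * d + e * e + f * f + g * g
    - a * c - b * d - c * d - d * e - e * f - f * g

-- Every nonzero class of `E₇ / 2E₇` with norms divisible by 4 contains a vector of norm 4. Shifting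
-- just the two coordinates `c` and `d` by 0 or 2 reaches one from the 0/1 representative, so a
-- finite check suffices.
set_option synthInstance.maxSize 1024 in
set_option synthInstance.maxHeartbeats 400000 in
theorem exists_small_lift : ∀ a b c d e f g : Fin 2,
    halfNormE7 a b c d e f g % 2 = 0 →
      (a = 0 ∧ b = 0 ∧ c = 0 ∧ d = 0 ∧ e = 0 ∧ f = 0 ∧ g = 0) ∨
      ∃ s t : Fin 2, halfNormE7 a b (c + 2 * s) (d + 2 * t) e f g = 2 := by
  decide +kernel

/-- A class of `E₈ / 2 E₈` that is orthogonal modulo two to the highest root, and whose squares are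
divisible by four, is zero or contains a vector of square `-4` orthogonal to the highest root. -/
theorem exists_E8_self_eq_neg_four {v : Fin 8 → ℤ} (hv : 4 ∣ E8 v v) (h7 : 2 ∣ v 7) :
    (∃ u, v = (2 : ℤ) • u) ∨
      ∃ u, E8 (v + (2 : ℤ) • u) (v + (2 : ℤ) • u) = -4 ∧ (v + (2 : ℤ) • u) 7 = 0 := by
  have hmod : ∀ a : ℤ, ∃ (e : Fin 2) (k : ℤ), a = (e : ℤ) + 2 * k := by
    intro a
    rcases Int.emod_two_eq_zero_or_one a with h | h
    · exact ⟨0, a / 2, by simp; omega⟩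
    · exact ⟨1, a / 2, by simp; omega⟩
  obtain ⟨e₀, k₀, h₀⟩ := hmod (v 0)
  obtain ⟨e₁, k₁, h₁⟩ := hmod (v 1)
  obtain ⟨e₂, k₂, h₂⟩ := hmod (v 2)
  obtain ⟨e₃, k₃, h₃⟩ := hmod (v 3)
  obtain ⟨e₄, k₄, h₄⟩ := hmod (v 4)
  obtain ⟨e₅, k₅, h₅⟩ := hmod (v 5)
  obtain ⟨e₆, k₆, h₆⟩ := hmod (v 6)
  obtain ⟨k₇, h₇⟩ := h7
  set ε : Fin 8 → ℤ := ![(e₀ : ℤ), e₁, e₂, e₃, e₄, e₅, e₆, 0] with hε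
  obtain ⟨k, hk⟩ : ∃ k : Fin 8 → ℤ, v = ε + (2 : ℤ) • k := by
    refine ⟨![k₀, k₁, k₂, k₃, k₄, k₅, k₆, k₇], ?_⟩
    ext i
    fin_cases i <;> simp [hε, h₀, h₁, h₂, h₃, h₄, h₅, h₆, h₇]
  have hnorm : E8 ε ε = -2 * halfNormE7 e₀ e₁ e₂ e₃ e₄ e₅ e₆ := by
    simp [E8_apply, hε, halfNormE7]; ring
  obtain ⟨c, hc⟩ := exists_E8_self_eq k
  have h4 : 4 ∣ E8 ε ε := by
    rw [hk] at hv
    simp only [map_add, map_smul, LinearMap.add_apply, LinearMap.smul_apply, smul_eq_mul,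
      E8_symm k ε] at hv
    omega
  rcases exists_small_lift e₀ e₁ e₂ e₃ e₄ e₅ e₆ (by omega) with h | ⟨s, t, hst⟩
  · left
    obtain ⟨rfl, rfl, rfl, rfl, rfl, rfl, rfl⟩ := h
    refine ⟨k, ?_⟩
    rw [hk, add_eq_right]
    ext i
    fin_cases i <;> simp [hε]
  · right
    refine ⟨![0, 0, (s : ℤ), t, 0, 0, 0, 0] - k, ?_⟩
    have : v + (2 : ℤ) • (![0, 0, (s : ℤ), t, 0, 0, 0, 0] - k) =
        ![(e₀ : ℤ), e₁, e₂ + 2 * s, e₃ + 2 * t, e₄, e₅, e₆, 0] := by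
      rw [hk, smul_sub, add_add_sub_cancel]
      ext i
      fin_cases i <;> simp [hε]
    rw [this]
    refine ⟨?_, rfl⟩
    simp [E8_apply]
    simp only [halfNormE7] at hst
    linarith

end Complement

/-! ### Comparison of the complements in `L(2)` and in `N`. -/

section Main

/-- The alternative for five vectors `p` of `N` that span a copy of `T`: a vector of square `-2` is
orthogonal to them, or their orthogonal complement is `E₇(2)`. -/
def ComplementDichotomy (p : Fin 5 → (Fin 2 → ℤ) × (Fin 2 → ℤ) × (Fin 8 → ℤ)) : Prop :=
  (∃ x, (∀ i, formN (p i) x = 0) ∧ formN x x = -2) ∨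
    ∃ h : (Fin 7 → ℤ) →ₗ[ℤ] (Fin 2 → ℤ) × (Fin 2 → ℤ) × (Fin 8 → ℤ),
      Function.Injective h ∧ (∀ a b, formN (h a) (h b) = twist E7 2 a b) ∧
        ∀ x, (∀ i, formN (p i) x = 0) ↔ ∃ a, h a = x

theorem orthogonal_standardVectors_iff (x : ℤ × ℤ × ℤ × ℤ × (Fin 8 → ℤ)) :
    (∀ i, hyperbolic (hyperbolic E8) (standardVectors i) x = 0) ↔
      ∃ a, (0, 0, 0, 0, inclE7 a) = x := by
  rcases x with ⟨a, b, c, d, v⟩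
  constructor
  · intro h
    have h0 := h 0
    have h1 := h 1
    have h2 := h 2
    have h3 := h 3
    have h4 := h 4
    simp [standardVectors, E8_highestRoot] at h0 h1 h2 h3 h4
    obtain ⟨y, hy⟩ := exists_inclE7_eq h4
    exact ⟨y, by simp [h0, h1, h2, h3, hy]⟩
  · rintro ⟨y, hy⟩ i
    rw [← hy]
    fin_cases i <;> simp [standardVectors, E8_highestRoot, inclE7_apply]

/-- The vector `w` below becomes divisible by 2 in `N` but not in `L`. The parity hypothesis says
that `w` is orthogonal modulo two to every `P i`, so modulo `2L` its image under `g` is a class `v`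
of `E₈` orthogonal modulo two to the highest root. -/
theorem exists_root_orthogonal {P : Fin 5 → ℤ × ℤ × ℤ × ℤ × (Fin 8 → ℤ)}
    {g : (hyperbolic (hyperbolic E8)).IsometryEquiv (hyperbolic (hyperbolic E8))}
    (hg : ∀ i, g (P i) = standardVectors i) (hP : ∀ i, 2 ∣ (P i).1) :
    ∃ x, (∀ i, formN (evenEmbedding (P i)) x = 0) ∧ formN x x = -2 := by
  set w : ℤ × ℤ × ℤ × ℤ × (Fin 8 → ℤ) := (0, 1, 0) with hw
  have hwP : ∀ i, 2 ∣ hyperbolic (hyperbolic E8) (standardVectors i) (g w) := fun i => by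
    rw [← hg, LinearMap.BilinForm.IsometryEquiv.map_app]
    simpa [hw] using hP i
  have hww : hyperbolic (hyperbolic E8) (g w) (g w) = 0 := by
    rw [LinearMap.BilinForm.IsometryEquiv.map_app]
    simp [hw]
  have hw2 : ∀ y, g w ≠ (2 : ℤ) • y := fun y hy => by
    have h1 : w = (2 : ℤ) • g.symm y := by
      rw [← map_smul, ← hy, isometryEquiv_symm_apply_apply]
    have h2 : (1 : ℤ) = 2 * (g.symm y).2.1 := congrArg (fun t => t.2.1) h1
    omega
  rcases hgw : g w with ⟨a, b, c, d, v⟩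
  rw [hgw] at hwP hww hw2
  have h0 := hwP 0
  have h1 := hwP 1
  have h2 := hwP 2
  have h3 := hwP 3
  have h4 := hwP 4
  simp [standardVectors, E8_highestRoot] at h0 h1 h2 h3 h4
  obtain ⟨a, rfl⟩ := h1
  obtain ⟨b, rfl⟩ := h0
  obtain ⟨c, rfl⟩ := h3
  obtain ⟨d, rfl⟩ := h2
  have hv : 4 ∣ E8 v v := by
    simp at hww
    exact ⟨-(2 * a * b + 2 * c * d), by linarith⟩
  rcases exists_E8_self_eq_neg_four hv h4 with ⟨u, rfl⟩ | ⟨u, hu, hu7⟩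
  · exact absurd (by simp) (hw2 (a, b, c, d, u))
  -- Correcting `w` by an element of `2L` turns its image under `g` into the vector of square `-4`;
  -- `k` is half of the corrected vector in `N`.
  · rcases hl : g.symm (-a, -b, -c, -d, u) with ⟨a', b', c', d', x'⟩
    have hs : g (w + (2 : ℤ) • (a', b', c', d', x')) = (0, 0, 0, 0, v + (2 : ℤ) • u) := by
      rw [map_add, map_smul, ← hl, isometryEquiv_apply_symm_apply, hgw]
      simp
    set k : (Fin 2 → ℤ) × (Fin 2 → ℤ) × (Fin 8 → ℤ) := (![a', 1 + 2 * b'], ![c', d'], x') with hk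
    have h2k : (2 : ℤ) • k = evenEmbedding (w + (2 : ℤ) • (a', b', c', d', x')) := by
      simp [hk, hw]
    obtain ⟨y, hy⟩ := exists_inclE7_eq hu7
    have ho := (orthogonal_standardVectors_iff (0, 0, 0, 0, v + (2 : ℤ) • u)).2 ⟨y, by rw [hy]⟩
    refine ⟨k, fun i => ?_, ?_⟩
    · have h5 : formN (evenEmbedding (P i)) ((2 : ℤ) • k) = 0 := by
        rw [h2k, formN_evenEmbedding, ← LinearMap.BilinForm.IsometryEquiv.map_app g, hs, hg, ho i,
          mul_zero]
      rw [map_smul, smul_eq_mul] at h5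
      omega
    · have h5 : formN ((2 : ℤ) • k) ((2 : ℤ) • k) = -8 := by
        rw [h2k, formN_evenEmbedding, ← LinearMap.BilinForm.IsometryEquiv.map_app g, hs]
        simp only [hyperbolic_apply, hu]
        norm_num
      simp only [map_smul, LinearMap.smul_apply, smul_eq_mul] at h5
      omega

theorem complementDichotomy_of_even {p : Fin 5 → (Fin 2 → ℤ) × (Fin 2 → ℤ) × (Fin 8 → ℤ)}
    (hp : ∀ i j, formN (p i) (p j) =
      2 * hyperbolic (hyperbolic E8) (standardVectors i) (standardVectors j))
    (heven : ∀ i, 2 ∣ (p i).1 1) : ComplementDichotomy p := by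
  choose P hP using fun i => exists_evenEmbedding_eq (heven i)
  obtain rfl : (fun i => evenEmbedding (P i)) = p := funext hP
  obtain ⟨g, hg⟩ := exists_isometry_standardVectors (P := P) fun i j => by
    have h := hp i j
    rw [formN_evenEmbedding] at h
    omega
  by_cases hodd : ∀ i, 2 ∣ (P i).1
  · exact Or.inl (exists_root_orthogonal hg hodd)
  push Not at hodd
  obtain ⟨i₀, hi₀⟩ := hodd
  have hiff : ∀ q, (∀ i, formN (evenEmbedding (P i)) (evenEmbedding q) = 0) ↔
      ∃ a, (0, 0, 0, 0, inclE7 a) = g q := fun q => by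
    rw [← orthogonal_standardVectors_iff]
    refine forall_congr' fun i => ?_
    rw [formN_evenEmbedding, ← hg, LinearMap.BilinForm.IsometryEquiv.map_app]
    omega
  let h : (Fin 7 → ℤ) →ₗ[ℤ] (Fin 2 → ℤ) × (Fin 2 → ℤ) × (Fin 8 → ℤ) :=
    evenEmbedding ∘ₗ (g.symm.toLinearEquiv : _ →ₗ[ℤ] _) ∘ₗ LinearMap.inr ℤ ℤ _ ∘ₗ
      LinearMap.inr ℤ ℤ _ ∘ₗ LinearMap.inr ℤ ℤ _ ∘ₗ LinearMap.inr ℤ ℤ _ ∘ₗ inclE7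
  have hh : ∀ a, h a = evenEmbedding (g.symm (0, 0, 0, 0, inclE7 a)) := fun _ => rfl
  refine Or.inr ⟨h, fun a b hab => ?_, fun a b => ?_, fun x => ⟨fun hx => ?_, ?_⟩⟩
  · rw [hh, hh] at hab
    have h1 := congrArg g (evenEmbedding_injective hab)
    simp only [isometryEquiv_apply_symm_apply, Prod.mk.injEq, true_and] at h1
    exact inclE7_injective h1
  · rw [hh, hh, formN_evenEmbedding, LinearMap.BilinForm.IsometryEquiv.map_app]
    simp [E8_inclE7, twist]
  · have h1 := hx i₀
    simp [formN_apply] at h1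
    -- Orthogonality to the one vector with odd first coordinate already forces `x` into the index
    -- two sublattice.
    have h2 : Even ((P i₀).1 * x.1 1) :=
      ⟨-((P i₀).2.1 * x.1 0 + ((P i₀).2.2.1 * x.2.1 1 + (P i₀).2.2.2.1 * x.2.1 0)
        + E8 (P i₀).2.2.2.2 x.2.2), by linarith⟩
    rw [Int.even_mul, even_iff_two_dvd, even_iff_two_dvd] at h2
    obtain ⟨q, rfl⟩ := exists_evenEmbedding_eq (h2.resolve_left hi₀)
    obtain ⟨a, ha⟩ := (hiff q).1 hx
    exact ⟨a, by rw [hh, ha, isometryEquiv_symm_apply_apply]⟩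
  · rintro ⟨a, rfl⟩
    rw [hh]
    exact (hiff _).2 ⟨a, by rw [isometryEquiv_apply_symm_apply]⟩

/-- The isometry of `N` that exchanges the two basis vectors of `U`. -/
noncomputable def swapN : formN.IsometryEquiv formN where
  toFun x := (![x.1 1, x.1 0], x.2)
  map_add' x y := by simp
  map_smul' c x := by simp
  invFun x := (![x.1 1, x.1 0], x.2)
  left_inv x := by
    ext i
    · fin_cases i <;> rfl
    · rfl
    · rfl
  right_inv x := by
    ext i
    · fin_cases i <;> rfl
    · rfl
    · rfl
  map_app' x y := by simp [formN_apply]; ring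

theorem swapN_apply (x : (Fin 2 → ℤ) × (Fin 2 → ℤ) × (Fin 8 → ℤ)) :
    swapN x = (![x.1 1, x.1 0], x.2) := rfl

theorem swapN_swapN (x : (Fin 2 → ℤ) × (Fin 2 → ℤ) × (Fin 8 → ℤ)) : swapN (swapN x) = x :=
  swapN.toLinearEquiv.symm_apply_apply x

theorem ComplementDichotomy.of_swapN {p : Fin 5 → (Fin 2 → ℤ) × (Fin 2 → ℤ) × (Fin 8 → ℤ)}
    (h : ComplementDichotomy fun i => swapN (p i)) : ComplementDichotomy p := by
  have key : ∀ i x, formN (p i) (swapN x) = formN (swapN (p i)) x := fun i x => by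
    rw [← LinearMap.BilinForm.IsometryEquiv.map_app swapN, swapN_swapN]
  rcases h with ⟨x, hx, hxx⟩ | ⟨h, hinj, hiso, hrange⟩
  · exact Or.inl ⟨swapN x, fun i => by rw [key, hx],
      by rw [LinearMap.BilinForm.IsometryEquiv.map_app, hxx]⟩
  · refine Or.inr ⟨(swapN.toLinearEquiv : _ →ₗ[ℤ] _) ∘ₗ h, swapN.toLinearEquiv.injective.comp hinj,
      fun a b => ?_, fun x => ?_⟩
    · rw [← hiso]
      exact swapN.map_app _ _
    · have h1 := hrange (swapN x)
      simp only [← key, swapN_swapN] at h1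
      rw [h1]
      refine exists_congr fun a => ⟨fun ha => ?_, fun ha => ?_⟩
      · change swapN (h a) = x
        rw [ha, swapN_swapN]
      · rw [← ha]
        exact (swapN_swapN _).symm

/-- The alternative holds for every embedding of `T` in `N`, primitive or not. -/
theorem complementDichotomy {p : Fin 5 → (Fin 2 → ℤ) × (Fin 2 → ℤ) × (Fin 8 → ℤ)}
    (hp : ∀ i j, formN (p i) (p j) =
      2 * hyperbolic (hyperbolic E8) (standardVectors i) (standardVectors j)) :
    ComplementDichotomy p := by
  by_cases hodd : ∀ i, 2 ∣ (p i).1 0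
  · refine ComplementDichotomy.of_swapN (complementDichotomy_of_even (fun i j => ?_) fun i => ?_)
    · rw [LinearMap.BilinForm.IsometryEquiv.map_app, hp]
    · simpa [swapN_apply] using hodd i
  push Not at hodd
  obtain ⟨i₀, hi₀⟩ := hodd
  -- Squares divisible by 4 make the product of the two `U`-coordinates of `p i₀` even; even
  -- pairings with `p i₀` then carry evenness of the second coordinate to every `p i`.
  have hself : ∀ i, 2 ∣ hyperbolic (hyperbolic E8) (standardVectors i) (standardVectors i) := by
    intro i
    fin_cases i <;> simp [standardVectors, E8_highestRoot]
    decide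
  have h0 : 2 ∣ (p i₀).1 1 := by
    have h1 := hp i₀ i₀
    rw [formN_apply] at h1
    obtain ⟨q, hq⟩ := exists_E8_self_eq (p i₀).2.2
    obtain ⟨t, ht⟩ := hself i₀
    have h2 : Even ((p i₀).1 0 * (p i₀).1 1) :=
      ⟨t - (p i₀).2.1 0 * (p i₀).2.1 1 - q, by rw [hq, ht] at h1; linarith⟩
    rw [Int.even_mul, even_iff_two_dvd, even_iff_two_dvd] at h2
    exact h2.resolve_left hi₀
  refine complementDichotomy_of_even hp fun i => ?_
  have h1 := hp i₀ i
  rw [formN_apply] at h1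
  obtain ⟨t, ht⟩ := h0
  have h2 : Even ((p i₀).1 0 * (p i).1 1) :=
    ⟨hyperbolic (hyperbolic E8) (standardVectors i₀) (standardVectors i) - t * (p i).1 0
      - ((p i₀).2.1 0 * (p i).2.1 1 + (p i₀).2.1 1 * (p i).2.1 0) - E8 (p i₀).2.2 (p i).2.2,
      by rw [ht] at h1; linarith⟩
  rw [Int.even_mul, even_iff_two_dvd, even_iff_two_dvd] at h2
  exact h2.resolve_left hi₀

/-- The standard basis of `T`. -/
def basisT : Fin 5 → (Fin 2 → ℤ) × (Fin 2 → ℤ) × (Fin 1 → ℤ) :=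
  ![(![1, 0], 0, 0), (![0, 1], 0, 0), (0, ![1, 0], 0), (0, ![0, 1], 0), (0, 0, ![1])]

theorem formT_basisT (i j : Fin 5) : formT (basisT i) (basisT j) =
    2 * hyperbolic (hyperbolic E8) (standardVectors i) (standardVectors j) := by
  fin_cases i <;> fin_cases j <;>
    simp [formT_apply, basisT, standardVectors, E8_highestRoot]
  simp [highestRoot]

theorem eq_sum_basisT (x : (Fin 2 → ℤ) × (Fin 2 → ℤ) × (Fin 1 → ℤ)) :
    x = x.1 0 • basisT 0 + x.1 1 • basisT 1 + x.2.1 0 • basisT 2 + x.2.1 1 • basisT 3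
      + x.2.2 0 • basisT 4 := by
  ext i
  · fin_cases i <;> simp [basisT]
  · fin_cases i <;> simp [basisT]
  · fin_cases i; simp [basisT]

theorem mem_complement_iff (φ : formT →bᵢ formN)
    (x : (Fin 2 → ℤ) × (Fin 2 → ℤ) × (Fin 8 → ℤ)) :
    x ∈ complement φ ↔ ∀ i, formN (φ (basisT i)) x = 0 := by
  rw [complement, LinearMap.BilinForm.mem_orthogonal_iff]
  constructor
  · exact fun h i => h _ ⟨basisT i, rfl⟩
  · rintro h _ ⟨t, rfl⟩
    rw [LinearMap.BilinForm.Isometry.coe_toLinearMap, eq_sum_basisT t]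
    simp only [map_add, map_smul, LinearMap.add_apply, LinearMap.smul_apply, h, smul_zero, add_zero]

end Main

end EnriquesLattice

theorem mainTheorem5
    (φ : EnriquesLattice.formT →bᵢ EnriquesLattice.formN)
    (hφ : EnriquesLattice.IsPrimitiveEmbedding φ)
    (hK : ∀ x ∈ EnriquesLattice.complement φ, EnriquesLattice.formN x x ≠ -2) :
    (EnriquesLattice.formN.restrict (EnriquesLattice.complement φ)).Equivalent
      (EnriquesLattice.twist EnriquesLattice.E7 2) := by
  have hp : ∀ i j, EnriquesLattice.formN (φ (EnriquesLattice.basisT i))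
      (φ (EnriquesLattice.basisT j)) = _ := fun i j => by
    rw [LinearMap.BilinForm.Isometry.map_app, EnriquesLattice.formT_basisT]
  rcases EnriquesLattice.complementDichotomy hp with ⟨x, hx, hxx⟩ | ⟨h, hinj, hiso, hrange⟩
  · exact absurd hxx (hK x ((EnriquesLattice.mem_complement_iff φ x).2 hx))
  · have hr : LinearMap.range h = EnriquesLattice.complement φ := by
      ext x
      rw [EnriquesLattice.mem_complement_iff, hrange, LinearMap.mem_range]
    let e := (LinearEquiv.ofInjective h hinj).trans (LinearEquiv.ofEq _ _ hr)
    let E : (EnriquesLattice.twist EnriquesLattice.E7 2).IsometryEquiv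
        (EnriquesLattice.formN.restrict (EnriquesLattice.complement φ)) :=
      { e with map_app' := hiso }
    exact ⟨E.symm⟩
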